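/- Let $K$ be an algebraically closed field of arbitrary characteristic. An algebroid curve $C:\{f=0\}$ is the ideal of $K[[x,y]]$ generated by a nonzero power series $f$ without constant term; its multiplicity is $m(C)=\mathrm{ord}\, f$. The curve $C$ is reduced if $f$ has no multiple factors, and it is a branch if $f$ is irreducible; the branches of $C$ are the curves $\{g=0\}$ with $g$ an irreducible factor of $f$. A branch is smooth if its multiplicity is $1$. For $C:\{f=0\}$ and $D:\{g=0\}$ put $(C,D)_0=\dim_K K[[x,y]]/(f,g)\in\mathbb N\cup\{+\infty\}$. For branches $C$, $D$ put $$d(C,D)=\frac{(C,D)_0}{m(C)\,m(D)}\in[0,+\infty],$$ and for reduced curves $C$, $D$ with branches $C_i$ and $D_j$ put $d(C,D)=\inf_{i,j} d(C_i,D_j)$. The contact exponent of a reduced curve $C$ is $$d(C)=\sup\{d(C,W) : W \text{ a smooth branch}\}\in[0,+\infty],$$ and a smooth branch $W$ has maximal contact with $C$ if $d(C,W)=d(C)$. Let $C$ be a reduced algebroid curve with $r>1$ (pairwise distinct) branches $C_1,\dots,C_r$. Then $$d(C)=\inf\Big\{\inf_i d(C_i),\ \inf_{i,j} d(C_i,C_j)\Big\}.$$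 Moreover, there exists $i_0\in\{1,\dots,r\}$ such that every smooth branch $W$ that has maximal contact with the branch $C_{i_0}$ has maximal contact with the curve $C$. -/

import Mathlib

open scoped ENNReal

noncomputable section

/-- An algebroid curve `C : {f = 0}`: the ideal of `K⟦x, y⟧` generated by a nonzero power series
`f` without constant term. -/
@[ext]
structure AlgebroidCurve (K : Type*) [Field K] where
  /-- the ideal that is the curve -/
  ideal : Ideal (MvPowerSeries (Fin 2) K)
  exists_equation : ∃ f : MvPowerSeries (Fin 2) K,
    f ≠ 0 ∧ MvPowerSeries.constantCoeff f = 0 ∧ ideal = Ideal.span {f}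

namespace AlgebroidCurve

variable {K : Type*} [Field K]

/-- The curve `{f = 0}`. -/
def ofSeries (f : MvPowerSeries (Fin 2) K) (hf : f ≠ 0)
    (hf₀ : MvPowerSeries.constantCoeff f = 0) : AlgebroidCurve K :=
  ⟨Ideal.span {f}, f, hf, hf₀, rfl⟩

/-- An equation of `C`; it is unique up to a unit factor. -/
def equation (C : AlgebroidCurve K) : MvPowerSeries (Fin 2) K :=
  C.exists_equation.choose

theorem equation_ne_zero (C : AlgebroidCurve K) : C.equation ≠ 0 :=
  C.exists_equation.choose_spec.1

theorem constantCoeff_equation (C : AlgebroidCurve K) :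
    MvPowerSeries.constantCoeff C.equation = 0 :=
  C.exists_equation.choose_spec.2.1

theorem ideal_eq_span_equation (C : AlgebroidCurve K) : C.ideal = Ideal.span {C.equation} :=
  C.exists_equation.choose_spec.2.2

instance : IsDomain (MvPowerSeries (Fin 2) K) := NoZeroDivisors.to_isDomain _

theorem associated_equation (C : AlgebroidCurve K) {f : MvPowerSeries (Fin 2) K}
    (h : C.ideal = Ideal.span {f}) : Associated C.equation f :=
  Ideal.span_singleton_eq_span_singleton.1 (C.ideal_eq_span_equation.symm.trans h)

/-- The multiplicity `m(C) = ord f`. -/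
def multiplicity (C : AlgebroidCurve K) : ℕ∞ := C.equation.order

theorem multiplicity_eq_order (C : AlgebroidCurve K) {f : MvPowerSeries (Fin 2) K}
    (h : C.ideal = Ideal.span {f}) : C.multiplicity = f.order := by
  obtain ⟨u, hu⟩ := C.associated_equation h
  have h0 : (u : MvPowerSeries (Fin 2) K).order = 0 := by
    by_contra hne
    have := (MvPowerSeries.order_ne_zero_iff_constCoeff_eq_zero).1 hne
    have hu' := u.isUnit.map (MvPowerSeries.constantCoeff (σ := Fin 2) (R := K))
    rw [this] at hu'
    exact not_isUnit_zero hu'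
  rw [← hu, MvPowerSeries.order_mul, h0, add_zero, multiplicity]

theorem multiplicity_ne_top (C : AlgebroidCurve K) : C.multiplicity ≠ ⊤ := fun h =>
  C.equation_ne_zero (MvPowerSeries.order_eq_top_iff.1 h)

theorem multiplicity_ne_zero (C : AlgebroidCurve K) : C.multiplicity ≠ 0 :=
  MvPowerSeries.order_ne_zero_iff_constCoeff_eq_zero.2 C.constantCoeff_equation

/-- The curve `{f = 0}` is reduced if `f` has no multiple factors. -/
def IsReduced (C : AlgebroidCurve K) : Prop := Squarefree C.equation

/-- A branch is an irreducible curve. -/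
def IsBranch (C : AlgebroidCurve K) : Prop := Irreducible C.equation

theorem isBranch_iff (C : AlgebroidCurve K) {f : MvPowerSeries (Fin 2) K}
    (h : C.ideal = Ideal.span {f}) : C.IsBranch ↔ Irreducible f :=
  (C.associated_equation h).irreducible_iff

theorem isReduced_iff (C : AlgebroidCurve K) {f : MvPowerSeries (Fin 2) K}
    (h : C.ideal = Ideal.span {f}) : C.IsReduced ↔ Squarefree f :=
  ⟨fun hs => hs.squarefree_of_dvd (C.associated_equation h).symm.dvd,
    fun hs => hs.squarefree_of_dvd (C.associated_equation h).dvd⟩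

/-- A smooth branch: a branch of multiplicity one. -/
def IsSmoothBranch (C : AlgebroidCurve K) : Prop := C.IsBranch ∧ C.multiplicity = 1

/-- The branches (irreducible components) of `C : {f = 0}`: the curves `{g = 0}` with `g` an
irreducible factor of `f`. -/
def branches (C : AlgebroidCurve K) : Set (AlgebroidCurve K) :=
  {B | B.IsBranch ∧ B.equation ∣ C.equation}

theorem branches_eq_singleton {C : AlgebroidCurve K} (hC : C.IsBranch) : C.branches = {C} := by
  ext B
  constructor
  · rintro ⟨hB, hd⟩
    apply AlgebroidCurve.ext
    rw [B.ideal_eq_span_equation, C.ideal_eq_span_equation]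
    exact Ideal.span_singleton_eq_span_singleton.2 (hB.associated_of_dvd hC hd)
  · rintro rfl
    exact ⟨hC, dvd_rfl⟩

/-- The intersection number `(C, D)₀ = dim_K K⟦x, y⟧ / (f, g)`, possibly infinite. -/
def intersectionNumber (C D : AlgebroidCurve K) : ℕ∞ :=
  Cardinal.toENat (Module.rank K (MvPowerSeries (Fin 2) K ⧸ (C.ideal ⊔ D.ideal)))

/-- The order of contact `(C, D)₀ / (m(C) m(D))` of two branches. -/
def branchContact (C D : AlgebroidCurve K) : ℝ≥0∞ :=
  (C.intersectionNumber D : ℝ≥0∞) / ((C.multiplicity : ℝ≥0∞) * (D.multiplicity : ℝ≥0∞))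

/-- The order of contact `d(C, D)` of two reduced curves: the infimum of the orders of contact of
their branches. -/
def contact (C D : AlgebroidCurve K) : ℝ≥0∞ :=
  ⨅ B ∈ C.branches, ⨅ E ∈ D.branches, branchContact B E

theorem contact_eq_branchContact {C D : AlgebroidCurve K} (hC : C.IsBranch) (hD : D.IsBranch) :
    contact C D = branchContact C D := by
  simp [contact, branches_eq_singleton hC, branches_eq_singleton hD]

/-- The contact exponent `d(C)`: the supremum of `d(C, W)` over all smooth branches `W`. -/
def contactExponent (C : AlgebroidCurve K) : ℝ≥0∞ :=
  ⨆ (W : AlgebroidCurve K) (_ : W.IsSmoothBranch), contact C W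

/-- The smooth branch `W` has maximal contact with `C`. -/
def HasMaximalContact (W C : AlgebroidCurve K) : Prop :=
  W.IsSmoothBranch ∧ contact C W = C.contactExponent

end AlgebroidCurve

end

/-! The heart is a strong triangle inequality for contact when one of the three branches, W, is
smooth. In generic linear coordinates C, D, W have Weierstrass polynomials `f`, `g`, `X - c` over
K⟦X⟧, of degrees m(C), m(D), 1. The absolute value of K⸨X⸩ extends to an algebraic closure as the
spectral norm, and intersection numbers are orders of norms. So for roots y of `f` and z of `g`, the
contacts of C and D with W measure |y - c| and |z - c|, and that of C with D measures |g(y)| = ∏ |y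
- z_j|. Conjugates z_j are equidistant from c, so the ultrametric inequality for y, z_j, c gives
both inequalities (`exists_ultrametric_root_distances`, `coe_le_branchContact_triangle`). No Puiseux
series or separability is needed, whence arbitrary characteristic.

Let R be the right-hand side. The inequality with W in the middle bounds every d(C,W) by R. With
C_{i₀} in the middle, it gives d(C,W) ≥ min(R, d(C_{i₀},W)). Since R ≤ d(C_{i₀}), taking suprema
yields d(C) = R, and any W of maximal contact with C_{i₀} attains it. Any index serves as i₀. -/

section

open Polynomial PowerSeries LaurentSeries WithZero

namespace LaurentSeries

variable (K : Type*) [Field K]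

/-- The `X`-adic valuation on `K⸨X⸩` has rank one, so that `K⸨X⸩` is a complete ultrametric field. -/
noncomputable instance rankOneValuation :
    Valuation.RankOne (Valued.v : Valuation K⸨X⸩ ℤᵐ⁰) where
  hom' := (WithZeroMulInt.toNNReal (e := 2) two_ne_zero).comp
    MonoidWithZeroHom.ValueGroup₀.embedding
  strictMono' := (WithZeroMulInt.toNNReal_strictMono (by norm_num)).comp
    MonoidWithZeroHom.ValueGroup₀.embedding_strictMono
  exists_val_nontrivial := by
    obtain ⟨x, hx⟩ := valuation_surjective K (exp (1 : ℤ))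
    refine ⟨x, ?_, ?_⟩ <;> rw [hx]
    · simp
    · decide

end LaurentSeries



/-! ### Spectral norms of roots and ultrametric distances -/

section SpectralNorm


theorem spectralNorm_eq_of_isConjRoot {F E : Type*} [NormedField F] [Field E] [Algebra F E]
    {x y : E} (h : IsConjRoot F x y) : spectralNorm F E x = spectralNorm F E y :=
  congrArg spectralValue h

/-- The spectral norm depends only on the minimal polynomial, and translation by an element of the
base field preserves conjugacy. -/
theorem spectralNorm_sub_algebraMap_eq {F E : Type*} [NormedField F] [Field E] [Algebra F E]
    [Algebra.IsAlgebraic F E] {p : F[X]} (hp : Irreducible p) {y z : E}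
    (hy : aeval y p = 0) (hz : aeval z p = 0) (c : F) :
    spectralNorm F E (y - algebraMap F E c) = spectralNorm F E (z - algebraMap F E c) := by
  have h : IsConjRoot F y z := by
    rw [isConjRoot_def, ← minpoly.eq_of_irreducible hp hy, ← minpoly.eq_of_irreducible hp hz]
  exact spectralNorm_eq_of_isConjRoot (h.sub_algebraMap c)

variable {F : Type*} [NontriviallyNormedField F] [CompleteSpace F] [IsUltrametricDist F]

/-- The norm of `x` is, up to a power, the spectral norm of any conjugate of `x`. -/
theorem norm_algebra_norm_eq_spectralNorm_pow {L E : Type*} [Field L] [Algebra F L]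
    [FiniteDimensional F L] [Field E] [Algebra F E] [Algebra.IsAlgebraic F E] [IsAlgClosed E]
    (σ : L →ₐ[F] E) (x : L) :
    ‖Algebra.norm F x‖ = spectralNorm F E (σ x) ^ Module.finrank F L := by
  have hx : IsIntegral F x := Algebra.IsIntegral.isIntegral x
  have h := congrArg (spectralMulAlgNorm F E)
    (Algebra.norm_eq_prod_roots (F := E) (IsAlgClosed.splits ((minpoly F x).map (algebraMap F E))))
  rw [map_pow, map_multiset_prod] at h
  have hroot : ((minpoly F x).aroots E).map (spectralMulAlgNorm F E) =
      Multiset.replicate (minpoly F x).natDegree (spectralNorm F E (σ x)) := by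
    rw [Multiset.eq_replicate]
    constructor
    · rw [Multiset.card_map, ← Polynomial.natDegree_map (algebraMap F E)]
      exact (IsAlgClosed.splits _).natDegree_eq_card_roots.symm
    · intro b hb
      obtain ⟨z, hz, rfl⟩ := Multiset.mem_map.1 hb
      have hz' := (Polynomial.mem_aroots.1 hz).2
      have hirr := minpoly.irreducible hx
      have h1 : aeval (σ x) (minpoly F x) = 0 := by
        rw [Polynomial.aeval_algHom_apply, minpoly.aeval, map_zero]
      have := spectralNorm_sub_algebraMap_eq hirr hz' h1 0
      rw [spectralMulAlgNorm_def]
      simpa using this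
  rw [hroot, Multiset.prod_replicate, spectralMulAlgNorm_def, spectralNorm_extends, ← pow_mul] at h
  rw [h, ← IntermediateField.adjoin.finrank hx, Module.finrank_mul_finrank]

variable (F) {A : Type*} [CommRing A] [IsDomain A] [Algebra A F] [IsFractionRing A F]
  (E : Type*) [Field E] [Algebra F E] [Algebra.IsAlgebraic F E] [IsAlgClosed E]
  [Algebra A E] [IsScalarTower A F E]

/-- The algebra norm commutes with localization, so `B` may be replaced by its fraction field, which
is finite over `F` and embeds in `E`. -/
theorem exists_algHom_norm_algebra_norm (A) [CommRing A] [IsDomain A] [Algebra A F]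
    [IsFractionRing A F] [Algebra A E] [IsScalarTower A F E]
    (B : Type*) [CommRing B] [IsDomain B] [Algebra A B]
    [Module.Free A B] [Module.Finite A B] :
    ∃ σ : B →ₐ[A] E, ∀ x : B, ‖algebraMap A F (Algebra.norm A x)‖ =
      spectralNorm F E (σ x) ^ Module.finrank A B := by
  have : FaithfulSMul A B := inferInstance
  let L := FractionRing B
  let : Algebra F L := ((IsFractionRing.lift (A := A) (K := F) (L := L)
    (g := algebraMap A L) (FaithfulSMul.algebraMap_injective A L))).toAlgebra
  have : IsScalarTower A F L := IsScalarTower.of_algebraMap_eq fun x => by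
    rw [RingHom.algebraMap_toAlgebra, IsFractionRing.lift_algebraMap]
  have : Module.Finite F L := Module.Finite.of_isLocalization A B (nonZeroDivisors A)
  let σ : L →ₐ[F] E := IsAlgClosed.lift
  refine ⟨(σ.restrictScalars A).comp (IsScalarTower.toAlgHom A B L), fun x => ?_⟩
  rw [← Algebra.norm_localization (Sₘ := L) A (nonZeroDivisors A),
    norm_algebra_norm_eq_spectralNorm_pow σ]
  congr 1
  have := (Module.finrank_eq_card_basis
    ((Module.Free.chooseBasis A B).localizationLocalization F (nonZeroDivisors A) L))
  rw [this, Module.finrank_eq_card_basis (Module.Free.chooseBasis A B)]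

/-- The root is the image of the adjoined one, so a single `y` serves all `g` at once. -/
theorem exists_root_norm_algebra_norm {f : A[X]} (hf : f.Monic)
    [IsDomain (AdjoinRoot f)] :
    ∃ y : E, aeval y f = 0 ∧ ∀ g : A[X],
      ‖algebraMap A F (Algebra.norm A (AdjoinRoot.mk f g))‖ =
        spectralNorm F E (aeval y g) ^ f.natDegree := by
  have := hf.free_adjoinRoot
  have := hf.finite_adjoinRoot
  obtain ⟨σ, hσ⟩ := exists_algHom_norm_algebra_norm F E A (AdjoinRoot f)
  have hmk : ∀ g : A[X], aeval (σ (AdjoinRoot.root f)) g = σ (AdjoinRoot.mk f g) := fun g => by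
    rw [Polynomial.aeval_algHom_apply, AdjoinRoot.aeval_eq]
  refine ⟨σ (AdjoinRoot.root f), ?_, fun g => ?_⟩
  · rw [hmk, AdjoinRoot.mk_self, map_zero]
  · rw [hσ, hmk, (AdjoinRoot.powerBasis' hf).finrank, AdjoinRoot.powerBasis'_dim]

omit [IsDomain A] [Algebra A F] [IsFractionRing A F] [IsScalarTower A F E] in
variable {F E} in
theorem spectralNorm_aeval_eq_prod (y : E) {g : A[X]} (hg : g.Monic) :
    spectralNorm F E (aeval y g) =
      ((g.aroots E).map fun z => spectralNorm F E (y - z)).prod := by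
  rw [(IsAlgClosed.splits (g.map (algebraMap A E))).aeval_eq_prod_aroots_of_monic hg,
    ← spectralMulAlgNorm_def, map_multiset_prod, Multiset.map_map]
  rfl

/-- The distances between `c`, a root of `f` and the roots of `g` form an ultrametric triangle; their
powers are the norms of the values at the roots. -/
theorem exists_ultrametric_root_distances [IsIntegrallyClosed A]
    {f g : A[X]} (hf : f.Monic) (hg : g.Monic) (hgi : Irreducible g)
    [IsDomain (AdjoinRoot f)] [IsDomain (AdjoinRoot g)] (c : A) :
    ∃ a b p : ℝ, 0 ≤ a ∧ 0 ≤ b ∧ 0 ≤ p ∧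
      ‖algebraMap A F (Algebra.norm A (AdjoinRoot.mk f (Polynomial.X - Polynomial.C c)))‖ = a ^ f.natDegree ∧
      ‖algebraMap A F (Algebra.norm A (AdjoinRoot.mk g (Polynomial.X - Polynomial.C c)))‖ = b ^ g.natDegree ∧
      ‖algebraMap A F (Algebra.norm A (AdjoinRoot.mk f g))‖ = p ^ f.natDegree ∧
      (∀ s, a ≤ s → b ≤ s → p ≤ s ^ g.natDegree) ∧
      (∀ s, 0 ≤ s → p ≤ s ^ g.natDegree → a ≤ s → b ≤ s) := by
  let E := AlgebraicClosure F
  obtain ⟨y, hy, hfy⟩ := exists_root_norm_algebra_norm F E hf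
  obtain ⟨z, hz, hgz⟩ := exists_root_norm_algebra_norm F E hg
  -- Gauss's lemma: the roots of `g` are conjugate over the fraction field.
  have hgF : Irreducible (g.map (algebraMap A F)) :=
    hg.irreducible_iff_irreducible_map_fraction_map.1 hgi
  have hroot : ∀ w ∈ g.aroots E, aeval w g = 0 := fun w hw => by
    rw [← Polynomial.eval_map_algebraMap]
    exact (Polynomial.mem_roots'.1 hw).2
  have hconj : ∀ w ∈ g.aroots E, spectralNorm F E (w - algebraMap A E c) =
      spectralNorm F E (z - algebraMap A E c) := fun w hw => by
    rw [IsScalarTower.algebraMap_apply A F E]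
    exact spectralNorm_sub_algebraMap_eq hgF
      (by rw [Polynomial.aeval_map_algebraMap]; exact hroot w hw)
      (by rw [Polynomial.aeval_map_algebraMap]; exact hz) _
  have hcard : Multiset.card (g.aroots E) = g.natDegree := by
    rw [Polynomial.aroots, ← (IsAlgClosed.splits _).natDegree_eq_card_roots,
      hg.natDegree_map]
  have hna : ∀ u v : E, spectralNorm F E (u - v) ≤
      max (spectralNorm F E u) (spectralNorm F E v) := fun u v => by
    have := isNonarchimedean_spectralNorm (K := F) (L := E) u (-v)
    rwa [spectralNorm_neg (Algebra.IsAlgebraic.isAlgebraic v), ← sub_eq_add_neg] at this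
  refine ⟨spectralNorm F E (y - algebraMap A E c), spectralNorm F E (z - algebraMap A E c),
    spectralNorm F E (aeval y g), spectralNorm_nonneg _, spectralNorm_nonneg _,
    spectralNorm_nonneg _, ?_, ?_, hfy g, ?_, ?_⟩
  · rw [hfy]; simp
  · rw [hgz]; simp
  · intro s ha hb
    rw [spectralNorm_aeval_eq_prod y hg, ← hcard]
    refine (Multiset.prod_map_le_prod_map₀ _ (fun _ => s) (fun w _ => spectralNorm_nonneg _)
      fun w hw => ?_).trans (by simp)
    rw [← sub_sub_sub_cancel_right y w (algebraMap A E c)]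
    exact (hna _ _).trans (max_le ha ((hconj w hw).le.trans hb))
  · intro s hs hp ha
    by_contra! hb
    have hn : g.natDegree ≠ 0 := (hg.natDegree_pos_of_not_isUnit hgi.not_isUnit).ne'
    refine hp.not_gt ((pow_lt_pow_left₀ hb hs hn).trans_le ?_)
    rw [spectralNorm_aeval_eq_prod y hg, ← hcard]
    refine le_trans (by simp) (Multiset.prod_map_le_prod_map₀
      (fun _ => spectralNorm F E (z - algebraMap A E c)) _
      (fun w _ => spectralNorm_nonneg _) fun w hw => ?_)
    -- Since w - c = (y - c) - (y - w) and |y - c| < |w - c|, the larger distance must be taken by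
    -- |y - w|.
    have h := hna (y - algebraMap A E c) (y - w)
    rw [sub_sub_sub_cancel_left, hconj w hw] at h
    exact (le_max_iff.1 h).resolve_left fun h => (hb.trans_le h).not_ge ha

end SpectralNorm

-- Here q = ‖X‖. A unit has norm 1 because it and its inverse both have norm at most 1.
open scoped Valued in
theorem LaurentSeries.exists_norm_coe_eq_pow_order (K : Type*) [Field K] :
    ∃ q : ℝ, 0 < q ∧ q < 1 ∧
      ∀ h : K⟦X⟧, h ≠ 0 → ‖algebraMap K⟦X⟧ K⸨X⸩ h‖ = q ^ h.order.toNat := by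
  have hunit : ∀ u : K⟦X⟧, ‖algebraMap K⟦X⟧ K⸨X⸩ u‖ ≤ 1 := fun u => by
    rw [Valued.toNormedField.norm_le_one_iff, val_le_one_iff_eq_coe]
    exact ⟨u, rfl⟩
  refine ⟨‖algebraMap K⟦X⟧ K⸨X⸩ PowerSeries.X‖, ?_, ?_, fun h hh => ?_⟩
  · rw [norm_pos_iff, ne_eq, FaithfulSMul.algebraMap_eq_zero_iff]
    exact PowerSeries.X_ne_zero
  · rw [Valued.toNormedField.norm_lt_one_iff]
    have := valuation_X_pow K 1
    rw [pow_one, Nat.cast_one] at this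
    refine this.trans_lt ?_
    rw [← exp_zero, exp_lt_exp]
    norm_num
  · have h1 := PowerSeries.X_pow_order_mul_divXPowOrder (f := h)
    have h2 : IsUnit h.divXPowOrder := by
      rw [PowerSeries.isUnit_iff_constantCoeff, isUnit_iff_ne_zero, ne_eq,
        PowerSeries.constantCoeff_divXPowOrder_eq_zero_iff]
      exact hh
    obtain ⟨u, hu⟩ := h2
    have h3 : ‖algebraMap K⟦X⟧ K⸨X⸩ u‖ = 1 := by
      refine le_antisymm (hunit _) ?_
      have h4 : ‖algebraMap K⟦X⟧ K⸨X⸩ (u : K⟦X⟧)‖ *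
          ‖algebraMap K⟦X⟧ K⸨X⸩ (↑u⁻¹ : K⟦X⟧)‖ = 1 := by
        rw [← norm_mul, ← map_mul, Units.mul_inv, map_one, norm_one]
      rw [← h4]
      exact mul_le_of_le_one_right (norm_nonneg _) (hunit _)
    conv_lhs => rw [← h1]
    rw [map_mul, map_pow, norm_mul, norm_pow, ← hu, h3, mul_one]

end

/-! ### Codimension of principal ideals over K⟦X⟧ -/

section

open Polynomial PowerSeries
namespace PowerSeries
variable (K : Type*) [Field K]

/-- The first `n` coefficients of a power series. -/
noncomputable def coeffFin (n : ℕ) : K⟦X⟧ →ₗ[K] (Fin n → K) :=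
  LinearMap.pi fun i => coeff (i : ℕ)

theorem coeffFin_surjective (n : ℕ) : Function.Surjective (coeffFin K n) := fun v =>
  ⟨mk fun i => if h : i < n then v ⟨i, h⟩ else 0, by ext i; simp [coeffFin]⟩

theorem ker_coeffFin (n : ℕ) :
    LinearMap.ker (coeffFin K n) = (Ideal.span {(X : K⟦X⟧) ^ n}).restrictScalars K := by
  ext f
  rw [LinearMap.mem_ker, Submodule.restrictScalars_mem, Ideal.mem_span_singleton, X_pow_dvd_iff]
  exact ⟨fun h m hm => congrFun h ⟨m, hm⟩, fun h => funext fun i => h i i.2⟩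

variable {K}

theorem rank_quotient_span_singleton {a : K⟦X⟧} (ha : a ≠ 0) :
    Module.rank K (K⟦X⟧ ⧸ Ideal.span {a}) = a.order.toNat := by
  have hspan : Ideal.span {a} = Ideal.span {(X : K⟦X⟧) ^ a.order.toNat} := by
    rw [Ideal.span_singleton_eq_span_singleton]
    have h2 : IsUnit a.divXPowOrder := by
      rw [isUnit_iff_constantCoeff, isUnit_iff_ne_zero, ne_eq,
        constantCoeff_divXPowOrder_eq_zero_iff]
      exact ha
    conv_lhs => rw [← X_pow_order_mul_divXPowOrder (f := a)]
    exact (associated_mul_isUnit_left_iff h2).2 (Associated.refl _)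
  rw [hspan]
  have e := (coeffFin K a.order.toNat).quotKerEquivOfSurjective (coeffFin_surjective K _)
  rw [ker_coeffFin] at e
  have e' : (K⟦X⟧ ⧸ Ideal.span {(X : K⟦X⟧) ^ a.order.toNat}) ≃ₗ[K] (Fin a.order.toNat → K) := e
  rw [e'.rank_eq]
  simp

theorem aleph0_le_rank : Cardinal.aleph0 ≤ Module.rank K K⟦X⟧ := by
  refine Cardinal.aleph0_le.2 fun n => ?_
  simpa using LinearMap.rank_le_of_surjective (coeffFin K n) (coeffFin_surjective K n)

variable {B : Type*} [CommRing B] [IsDomain B] [Algebra K⟦X⟧ B] [Module.Free K⟦X⟧ B]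
  [Module.Finite K⟦X⟧ B] [Algebra K B] [IsScalarTower K K⟦X⟧ B]

/-- The codimension of a principal ideal is the order of the norm of its generator. -/
theorem toENat_rank_quotient_span_singleton (h : B) :
    Cardinal.toENat (Module.rank K (B ⧸ Ideal.span {h})) = (Algebra.norm K⟦X⟧ h).order := by
  let b := Module.Free.chooseBasis K⟦X⟧ B
  by_cases hh : h = 0
  · subst hh
    rw [Algebra.norm_zero, order_zero, Cardinal.toENat_eq_top]
    have e : (B ⧸ Ideal.span {(0 : B)}) ≃ₗ[K] B :=
      (Submodule.quotEquivOfEqBot (Ideal.span {(0:B)}) (by simp)).restrictScalars K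
    rw [e.rank_eq]
    have hinj : Function.Injective (IsScalarTower.toAlgHom K K⟦X⟧ B).toLinearMap :=
      FaithfulSMul.algebraMap_injective K⟦X⟧ B
    have := LinearMap.lift_rank_le_of_injective _ hinj
    rw [← Cardinal.lift_le, Cardinal.lift_aleph0]
    refine le_trans ?_ this
    simpa using aleph0_le_rank
  · have hI : Ideal.span {h} ≠ ⊥ := Ideal.span_singleton_eq_bot.not.2 hh
    -- Smith normal form over K⟦X⟧ splits the quotient into cyclic pieces; the product of the Smith
    -- coefficients is the norm up to a unit.
    have e := (Ideal.quotientEquivPiSpan (Ideal.span {h}) b hI).restrictScalars K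
    have hc := fun i => Ideal.smithCoeffs_ne_zero b _ hI i
    obtain ⟨u, hu⟩ := associated_norm_prod_smith b hh
    have hfin : ∀ i, Module.Finite K
        (K⟦X⟧ ⧸ Ideal.span {(Ideal.span {h}).smithCoeffs b hI i}) := fun i =>
      Module.rank_lt_aleph0_iff.1 <| by
        rw [rank_quotient_span_singleton (hc i)]
        exact Cardinal.natCast_lt_aleph0
    have : Module.Finite K (B ⧸ Ideal.span {h}) := Module.Finite.equiv e.symm
    have hu' : (u : K⟦X⟧).order = 0 := order_zero_of_unit u.isUnit
    rw [← Module.finrank_eq_rank, e.finrank_eq, Module.finrank_pi_fintype, map_natCast,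
      ← add_zero (Algebra.norm K⟦X⟧ h).order, ← hu', ← order_mul, hu, order_prod, Nat.cast_sum]
    refine Finset.sum_congr rfl fun i _ => ?_
    rw [Module.finrank_eq_of_rank_eq (rank_quotient_span_singleton (hc i)),
      coe_toNat_order (hc i)]

end PowerSeries

end

/-! ### Generic linear coordinates on the plane -/

section

namespace MvPowerSeries
variable (K : Type*) [Field K]

/-- Power series in two variables as power series in `X 0` over `K⟦X 1⟧`. -/
noncomputable def finTwoEquiv : MvPowerSeries (Fin 2) K ≃ₐ[K] PowerSeries (PowerSeries K) :=
  (renameEquiv K ((_root_.finSuccEquiv 1).trans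
    (Equiv.optionCongr (Equiv.equivPUnit.{1, 1} (Fin 1))))).trans (optionEquivLeft Unit K)

/-- The restriction `f(t, 0)` of `f` to the axis `X 1 = 0`. -/
noncomputable def restrictAxis : MvPowerSeries (Fin 2) K →+* PowerSeries K :=
  (PowerSeries.map PowerSeries.constantCoeff).comp (finTwoEquiv K : _ →+* _)

variable {K}

theorem coeff_restrictAxis (p : MvPowerSeries (Fin 2) K) (n : ℕ) :
    PowerSeries.coeff n (restrictAxis K p) = coeff (Finsupp.single 0 n) p := by
  let e := (_root_.finSuccEquiv 1).trans (Equiv.optionCongr (Equiv.equivPUnit.{1, 1} (Fin 1)))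
  have h : Finsupp.optionElim n (0 : Unit →₀ ℕ) =
      Finsupp.embDomain e.toEmbedding (Finsupp.single 0 n) := by
    rw [Finsupp.embDomain_single]
    ext a
    cases a <;> simp [e]
  change coeff 0 (PowerSeries.coeff n (optionEquivLeft Unit K (rename e p))) = _
  rw [coeff_coeff_optionEquivLeft, h]
  exact coeff_embDomain_rename _ _ _

theorem restrictAxis_X_zero : restrictAxis K (X 0) = PowerSeries.X := by
  ext n
  rw [coeff_restrictAxis, coeff_X, PowerSeries.coeff_X]
  simp [Finsupp.single_apply, Finsupp.ext_iff, Fin.forall_fin_two]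

theorem restrictAxis_X_one : restrictAxis K (X 1) = 0 := by
  ext n
  rw [coeff_restrictAxis, coeff_X, if_neg, map_zero]
  intro h
  simpa using DFunLike.congr_fun h 1

theorem restrictAxis_C (c : K) : restrictAxis K (C c) = PowerSeries.C c := by
  ext n
  rw [coeff_restrictAxis, coeff_C, PowerSeries.coeff_C]
  simp

/-- The substitution `X 0 ↦ X 0`, `X 1 ↦ X 1 + c * X 0`. -/
noncomputable def shearSubst (c : K) : Fin 2 → MvPowerSeries (Fin 2) K :=
  ![X 0, X 1 + C c * X 0]

theorem hasSubst_shearSubst (c : K) : HasSubst (shearSubst c) :=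
  hasSubst_of_constantCoeff_zero fun i => by fin_cases i <;> simp [shearSubst]

theorem substAlgHom_shearSubst_comp (c : K) (f : MvPowerSeries (Fin 2) K) :
    substAlgHom (R := K) (hasSubst_shearSubst (-c))
      (substAlgHom (R := K) (hasSubst_shearSubst c) f) = f := by
  rw [substAlgHom_comp_substAlgHom_apply]
  have h0 : substAlgHom (R := K) (hasSubst_shearSubst (-c)) (X 0) = X 0 :=
    substAlgHom_X _ 0
  have h1 : substAlgHom (R := K) (hasSubst_shearSubst (-c)) (X 1) = X 1 + C (-c) * X 0 :=
    substAlgHom_X _ 1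
  have : (fun s => substAlgHom (R := K) (hasSubst_shearSubst (-c)) (shearSubst c s)) = X := by
    funext s
    fin_cases s
    · exact h0
    · change substAlgHom (R := K) (hasSubst_shearSubst (-c)) (X 1 + C c * X 0) = X 1
      have hC : substAlgHom (R := K) (hasSubst_shearSubst (-c)) (C c) = C c :=
        (substAlgHom (R := K) (hasSubst_shearSubst (-c))).commutes c
      rw [map_add, map_mul, hC, h0, h1, map_neg]
      ring
  rw [substAlgHom_apply, this, subst_self, id]

/-- The linear change of coordinates `X 0 ↦ X 0`, `X 1 ↦ X 1 + c * X 0`. -/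
noncomputable def shear (c : K) : MvPowerSeries (Fin 2) K ≃ₐ[K] MvPowerSeries (Fin 2) K :=
  AlgEquiv.ofAlgHom (substAlgHom (R := K) (hasSubst_shearSubst c))
    (substAlgHom (R := K) (hasSubst_shearSubst (-c)))
    (AlgHom.ext fun f => by
      simpa using substAlgHom_shearSubst_comp (-c) f)
    (AlgHom.ext fun f => substAlgHom_shearSubst_comp c f)

/-- The value at `(1, T)` of the homogeneous component of degree `n` of `f`. -/
noncomputable def homogeneousPoly (n : ℕ) (f : MvPowerSeries (Fin 2) K) : Polynomial K :=
  ∑ d ∈ Finset.finsuppAntidiag Finset.univ n, Polynomial.monomial (d 1) (coeff d f)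

theorem mem_finsuppAntidiag_iff {n : ℕ} {d : Fin 2 →₀ ℕ} :
    d ∈ Finset.finsuppAntidiag Finset.univ n ↔ d 0 + d 1 = n := by
  simp [Finset.mem_finsuppAntidiag]

theorem homogeneousPoly_ne_zero {n : ℕ} {f : MvPowerSeries (Fin 2) K} {d : Fin 2 →₀ ℕ}
    (hd : d.degree = n) (hf : coeff d f ≠ 0) : homogeneousPoly n f ≠ 0 := by
  have hd' : d 0 + d 1 = n := by rw [← hd, Finsupp.degree_eq_sum, Fin.sum_univ_two]
  intro h
  apply hf
  have h1 := congrArg (fun p => Polynomial.coeff p (d 1)) h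
  simp only [homogeneousPoly, Polynomial.finsetSum_coeff, Polynomial.coeff_zero,
    Polynomial.coeff_monomial] at h1
  rw [Finset.sum_eq_single_of_mem d (mem_finsuppAntidiag_iff.2 hd'), if_pos rfl] at h1
  · exact h1
  · intro e he hne
    rw [if_neg]
    intro h2
    apply hne
    have := mem_finsuppAntidiag_iff.1 he
    ext i
    fin_cases i <;> simp <;> omega

/-- On the axis the shear becomes (t, ct), so a monomial of exponent `d` contributes only in degree
`d 0 + d 1`. -/
theorem coeff_restrictAxis_shear (c : K) (n : ℕ) (f : MvPowerSeries (Fin 2) K) :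
    PowerSeries.coeff n (restrictAxis K (shear c f)) = (homogeneousPoly n f).eval c := by
  have h : shear c f = subst (shearSubst c) f := by
    rw [← coe_substAlgHom (hasSubst_shearSubst c)]; rfl
  have key : ∀ d : Fin 2 →₀ ℕ, coeff (Finsupp.single 0 n) (d.prod fun s e => shearSubst c s ^ e) =
      if d 0 + d 1 = n then c ^ d 1 else 0 := fun d => by
    rw [← coeff_restrictAxis, Finsupp.prod_fintype _ _ (by simp), Fin.prod_univ_two]
    simp only [shearSubst, Matrix.cons_val_zero, Matrix.cons_val_one, map_mul, map_pow, map_add,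
      restrictAxis_X_zero, restrictAxis_X_one, restrictAxis_C, zero_add]
    rw [mul_pow, mul_left_comm, ← pow_add, ← map_pow, PowerSeries.coeff_C_mul,
      PowerSeries.coeff_X_pow]
    simp [eq_comm]
  rw [coeff_restrictAxis, h, coeff_subst (hasSubst_shearSubst c)]
  simp only [key]
  rw [finsum_eq_sum_of_support_subset (s := Finset.finsuppAntidiag Finset.univ n)]
  · rw [homogeneousPoly, Polynomial.eval_finsetSum]
    refine Finset.sum_congr rfl fun d hd => ?_
    rw [if_pos (mem_finsuppAntidiag_iff.1 hd), Polynomial.eval_monomial, smul_eq_mul]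
  · intro d hd
    rw [Finset.mem_coe, mem_finsuppAntidiag_iff]
    by_contra hne
    exact hd (by simp [hne])

theorem order_le_order_restrictAxis_shear (c : K) (f : MvPowerSeries (Fin 2) K) :
    f.order ≤ (restrictAxis K (shear c f)).order := by
  refine PowerSeries.le_order _ _ fun n hn => ?_
  rw [coeff_restrictAxis_shear, homogeneousPoly, Finset.sum_eq_zero, Polynomial.eval_zero]
  intro d hd
  rw [coeff_of_lt_order, Polynomial.monomial_zero_right]
  rwa [Finsupp.degree_eq_sum, Fin.sum_univ_two, mem_finsuppAntidiag_iff.1 hd]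

/-- The leading form gives a nonzero polynomial in the slope, which has a non-root over an infinite
field. -/
theorem exists_order_restrictAxis_shear_eq [Infinite K] {f : MvPowerSeries (Fin 2) K}
    (hf : f ≠ 0) : ∃ c : K, (restrictAxis K (shear c f)).order = f.order := by
  obtain ⟨d, hd, hdf⟩ := exists_coeff_ne_zero_and_order (ne_zero_iff_order_finite.1 hf)
  have hP := homogeneousPoly_ne_zero rfl hd
  obtain ⟨c, hc⟩ : ∃ c, (homogeneousPoly d.degree f).eval c ≠ 0 := by
    by_contra! h
    exact hP (Polynomial.funext fun c => by rw [h, Polynomial.eval_zero])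
  refine ⟨c, le_antisymm ?_ (order_le_order_restrictAxis_shear c f)⟩
  rw [← hdf]
  exact PowerSeries.order_le _ (by rwa [coeff_restrictAxis_shear])

end MvPowerSeries

end

/-! ### Weierstrass preparation and intersection numbers -/

section

open Polynomial PowerSeries LaurentSeries

section Weierstrass

variable {K : Type*} [Field K]

instance PowerSeries.isAdicComplete_maximalIdeal :
    IsAdicComplete (IsLocalRing.maximalIdeal K⟦X⟧) K⟦X⟧ := by
  rw [PowerSeries.maximalIdeal_eq_span_X]
  infer_instance

theorem PowerSeries.residue_eq_zero_iff_constantCoeff (a : K⟦X⟧) :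
    IsLocalRing.residue K⟦X⟧ a = 0 ↔ constantCoeff a = 0 := by
  rw [IsLocalRing.residue_eq_zero_iff, maximalIdeal_eq_span_X, Ideal.mem_span_singleton, X_dvd_iff]

theorem PowerSeries.order_map_residue (F : K⟦X⟧⟦X⟧) :
    (F.map (IsLocalRing.residue K⟦X⟧)).order = (F.map (constantCoeff (R := K))).order := by
  refine le_antisymm (le_order _ _ fun n hn => ?_) (le_order _ _ fun n hn => ?_)
  · have := coeff_of_lt_order n hn
    rwa [coeff_map, residue_eq_zero_iff_constantCoeff, ← coeff_map] at this
  · have := coeff_of_lt_order n hn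
    rwa [coeff_map, ← residue_eq_zero_iff_constantCoeff, ← coeff_map] at this

/-- A monic factor of `p` reduces to a power of X. If it is a unit as a power series, its constant
term is a unit, so that power is trivial and the factor has degree 0. -/
theorem Polynomial.IsDistinguishedAt.irreducible_of_irreducible_coe {A : Type*} [CommRing A]
    [IsDomain A] [IsLocalRing A] {p : A[X]}
    (hp : p.IsDistinguishedAt (IsLocalRing.maximalIdeal A)) (hirr : Irreducible (p : A⟦X⟧)) :
    Irreducible p := by
  have hp1 : p ≠ 1 := by
    rintro rfl
    exact hirr.not_isUnit (by simp)
  have key : ∀ a b : A[X], a.Monic → a * b = p → IsUnit (a : A⟦X⟧) → a.natDegree = 0 := by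
    intro a b ha hab hu
    have h1 : a.map (IsLocalRing.residue A) ∣ Polynomial.X ^ p.natDegree := by
      have h2 := hp.map_eq_X_pow
      rw [← hab] at h2 ⊢
      exact ⟨b.map (IsLocalRing.residue A), by rw [← Polynomial.map_mul]; exact h2.symm⟩
    obtain ⟨k, -, hk⟩ := (dvd_prime_pow Polynomial.prime_X _).1 h1
    have hk' := Polynomial.eq_of_monic_of_associated (ha.map _) (Polynomial.monic_X_pow k) hk
    have h3 : IsUnit (a.coeff 0) := by
      have := PowerSeries.isUnit_iff_constantCoeff.1 hu
      simpa using this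
    have h4 : k = 0 := by
      by_contra hk0
      have h5 := congrArg (fun r => Polynomial.coeff r 0) hk'
      simp only [Polynomial.coeff_map, Polynomial.coeff_X_pow, if_neg (Ne.symm hk0)] at h5
      exact (h3.map (IsLocalRing.residue A)).ne_zero h5
    rw [h4, pow_zero] at hk'
    rw [← ha.natDegree_map (IsLocalRing.residue A), hk',
      Polynomial.natDegree_one]
  refine (Polynomial.Monic.irreducible_iff_natDegree hp.monic).2 ⟨hp1, fun a b ha hb hab => ?_⟩
  · have hab' : (p : A⟦X⟧) = a * b := by rw [← hab, Polynomial.coe_mul]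
    rcases hirr.isUnit_or_isUnit hab' with h | h
    · exact Or.inl (key a b ha hab h)
    · exact Or.inr (key b a hb (by rw [mul_comm, hab]) h)

theorem PowerSeries.exists_weierstrass_polynomial {F : K⟦X⟧⟦X⟧} {m : ℕ}
    (hm : (F.map (constantCoeff (R := K))).order = m) :
    ∃ p : K⟦X⟧[X], ∃ u : K⟦X⟧⟦X⟧, F.IsWeierstrassFactorization p u ∧ p.natDegree = m := by
  rw [← order_map_residue] at hm
  have h0 : F.map (IsLocalRing.residue K⟦X⟧) ≠ 0 := by
    rw [ne_eq, ← order_eq_top, hm]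
    exact ENat.natCast_ne_top m
  obtain ⟨p, u, h⟩ := exists_isWeierstrassFactorization h0
  exact ⟨p, u, h, by rw [h.natDegree_eq_toNat_order_map, hm, ENat.toNat_natCast]⟩

theorem PowerSeries.IsWeierstrassFactorization.associated {F : K⟦X⟧⟦X⟧} {p : K⟦X⟧[X]}
    {u : K⟦X⟧⟦X⟧} (h : F.IsWeierstrassFactorization p u) : Associated (p : K⟦X⟧⟦X⟧) F := by
  rw [h.eq_mul]
  exact (associated_mul_isUnit_right_iff h.isUnit).2 (Associated.refl _)

/-- The quotient by a power series is the quotient by its Weierstrass polynomial. -/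
noncomputable def PowerSeries.IsWeierstrassFactorization.adjoinRootEquiv {A : Type*} [CommRing A]
    [IsLocalRing A] [IsAdicComplete (IsLocalRing.maximalIdeal A) A] {F : A⟦X⟧}
    {p : A[X]} {u : A⟦X⟧} (h : F.IsWeierstrassFactorization p u) :
    AdjoinRoot p ≃+* (A⟦X⟧ ⧸ Ideal.span {F}) :=
  h.algEquivQuotient.toRingEquiv

theorem PowerSeries.IsWeierstrassFactorization.adjoinRootEquiv_mk {A : Type*} [CommRing A]
    [IsLocalRing A] [IsAdicComplete (IsLocalRing.maximalIdeal A) A] {F : A⟦X⟧}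
    {p : A[X]} {u : A⟦X⟧} (h : F.IsWeierstrassFactorization p u) (r : A[X]) :
    h.adjoinRootEquiv (AdjoinRoot.mk p r) = Ideal.Quotient.mk _ (r : A⟦X⟧) := by
  change h.algEquivQuotient (Ideal.Quotient.mk _ r) = _
  rw [PowerSeries.IsWeierstrassFactorizationAt.algEquivQuotient_apply]
  simp

/-- The intersection number of `F` and `G` is the order of the norm of an equation of `G` modulo the
Weierstrass polynomial of `F`. -/
theorem PowerSeries.IsWeierstrassFactorization.toENat_rank_quotient_sup {F G : K⟦X⟧⟦X⟧}
    {p g : K⟦X⟧[X]} {u : K⟦X⟧⟦X⟧} (h : F.IsWeierstrassFactorization p u)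
    (hG : Associated (g : K⟦X⟧⟦X⟧) G) [IsDomain (AdjoinRoot p)] :
    Cardinal.toENat (Module.rank K (K⟦X⟧⟦X⟧ ⧸ (Ideal.span {F} ⊔ Ideal.span {G}))) =
      (Algebra.norm K⟦X⟧ (AdjoinRoot.mk p g)).order := by
  have := h.isDistinguishedAt.monic.free_adjoinRoot
  have := h.isDistinguishedAt.monic.finite_adjoinRoot
  let e : AdjoinRoot p ≃ₐ[K] (K⟦X⟧⟦X⟧ ⧸ Ideal.span {F}) :=
    AlgEquiv.ofRingEquiv (f := h.adjoinRootEquiv) fun r =>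
      (h.adjoinRootEquiv_mk (Polynomial.C (PowerSeries.C r))).trans
        (by rw [Polynomial.coe_C]
            exact congrArg (Ideal.Quotient.mk (Ideal.span {F}))
              (MvPowerSeries.algebraMap_apply (σ := Unit) (A := K⟦X⟧) (r := r)).symm)
  have hIJ : (Ideal.span {G}).map (Ideal.Quotient.mkₐ K (Ideal.span {F})) =
      (Ideal.span {AdjoinRoot.mk p g}).map (e : AdjoinRoot p →+* _) := by
    rw [← Ideal.span_singleton_eq_span_singleton.2 hG, Ideal.map_span, Ideal.map_span,
      Set.image_singleton, Set.image_singleton]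
    exact congrArg (fun x => Ideal.span {x}) (h.adjoinRootEquiv_mk g).symm
  rw [← toENat_rank_quotient_span_singleton]
  exact congrArg _ ((Ideal.quotientEquivAlg _ _ e hIJ).trans
    (DoubleQuot.quotQuotEquivQuotSupₐ K _ _)).toLinearEquiv.rank_eq.symm

end Weierstrass

end

/-! ### The strong triangle inequality for contact -/

open Polynomial PowerSeries LaurentSeries

namespace MvPowerSeries

variable {K : Type*} [Field K]

/-- Coordinates in which none of three given series is tangent to the first axis. -/
theorem exists_algEquiv_order_eq [Infinite K] {f g w : MvPowerSeries (Fin 2) K}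
    (hf : f ≠ 0) (hg : g ≠ 0) (hw : w ≠ 0) :
    ∃ Φ : MvPowerSeries (Fin 2) K ≃ₐ[K] K⟦X⟧⟦X⟧,
      ((Φ f).map (PowerSeries.constantCoeff (R := K))).order = f.order ∧
      ((Φ g).map (PowerSeries.constantCoeff (R := K))).order = g.order ∧
      ((Φ w).map (PowerSeries.constantCoeff (R := K))).order = w.order := by
  -- One slope generic for the product suffices: restriction never lowers an order, so equality of
  -- the finite sums forces equality of each term.
  obtain ⟨c, hc⟩ := exists_order_restrictAxis_shear_eq (mul_ne_zero (mul_ne_zero hf hg) hw)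
  have h1 := order_le_order_restrictAxis_shear c f
  have h2 := order_le_order_restrictAxis_shear c g
  have h3 := order_le_order_restrictAxis_shear c w
  obtain ⟨i, hi⟩ : ∃ i : ℕ, f.order = i := ⟨_, (ne_zero_iff_order_finite.1 hf).symm⟩
  obtain ⟨j, hj⟩ : ∃ j : ℕ, g.order = j := ⟨_, (ne_zero_iff_order_finite.1 hg).symm⟩
  obtain ⟨k, hk⟩ : ∃ k : ℕ, w.order = k := ⟨_, (ne_zero_iff_order_finite.1 hw).symm⟩
  simp only [map_mul, PowerSeries.order_mul, order_mul] at hc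
  refine ⟨(shear c).trans (finTwoEquiv K), ?_⟩
  change (restrictAxis K (shear c f)).order = _ ∧ (restrictAxis K (shear c g)).order = _ ∧
    (restrictAxis K (shear c w)).order = _
  rw [hi] at h1
  rw [hj] at h2
  rw [hk] at h3
  rw [hi, hj, hk] at hc ⊢
  generalize (restrictAxis K (shear c f)).order = a at *
  generalize (restrictAxis K (shear c g)).order = b at *
  generalize (restrictAxis K (shear c w)).order = d at *
  induction a with
  | top => simp [← Nat.cast_add] at hc
  | coe a =>
  induction b with
  | top => simp [← Nat.cast_add] at hc
  | coe b =>
  induction d with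
  | top => simp [← Nat.cast_add] at hc
  | coe d =>
  norm_cast at *
  omega

end MvPowerSeries

/-- Since q < 1, powers of q reverse the order. Comparing with finite thresholds `t` handles
infinite order too: `h = 0` satisfies both sides. -/
theorem ENNReal.coe_le_order_div_iff {K : Type*} [Field K] {ν : K⟦X⟧ → ℝ} {q : ℝ} (hq0 : 0 < q)
    (hq1 : q < 1) (hν0 : ν 0 = 0) (hν : ∀ h, h ≠ 0 → ν h = q ^ h.order.toNat)
    (h : K⟦X⟧) {k : ℕ} (hk : k ≠ 0) (t : NNReal) :
    (t : ℝ≥0∞) ≤ (h.order : ℝ≥0∞) / k ↔ ν h ≤ (q ^ (t : ℝ)) ^ k := by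
  by_cases h0 : h = 0
  · subst h0
    rw [hν0, PowerSeries.order_zero, ENat.toENNReal_top,
      ENNReal.top_div_of_ne_top (ENNReal.natCast_ne_top k)]
    simp only [le_top, true_iff]
    positivity
  · rw [hν h h0, ← PowerSeries.coe_toNat_order h0]
    simp only [ENat.toNat_natCast, ENat.toENNReal_coe]
    rw [ENNReal.le_div_iff_mul_le (Or.inl (by exact_mod_cast hk))
      (Or.inl (ENNReal.natCast_ne_top k)), ← Real.rpow_natCast, ← Real.rpow_natCast,
      ← Real.rpow_mul hq0.le, Real.rpow_le_rpow_left_iff_of_base_lt_one hq0 hq1]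
    norm_cast

namespace AlgebroidCurve

variable {K : Type*} [Field K]

theorem intersectionNumber_eq_of_algEquiv (C D : AlgebroidCurve K)
    (Φ : MvPowerSeries (Fin 2) K ≃ₐ[K] K⟦X⟧⟦X⟧) :
    C.intersectionNumber D = Cardinal.toENat (Module.rank K
      (K⟦X⟧⟦X⟧ ⧸ (Ideal.span {Φ C.equation} ⊔ Ideal.span {Φ D.equation}))) := by
  refine congrArg _ (Ideal.quotientEquivAlg _ _ Φ ?_).toLinearEquiv.rank_eq
  rw [C.ideal_eq_span_equation, D.ideal_eq_span_equation, Ideal.map_sup, Ideal.map_span,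
    Ideal.map_span, Set.image_singleton, Set.image_singleton]
  rfl

/-- A distinguished polynomial defining a branch in the coordinates `Φ`. -/
theorem IsBranch.exists_weierstrass_polynomial {C : AlgebroidCurve K} (hC : C.IsBranch)
    {Φ : MvPowerSeries (Fin 2) K ≃ₐ[K] K⟦X⟧⟦X⟧}
    (hΦ : ((Φ C.equation).map (PowerSeries.constantCoeff (R := K))).order = C.equation.order) :
    ∃ p : K⟦X⟧[X], ∃ u : K⟦X⟧⟦X⟧, (Φ C.equation).IsWeierstrassFactorization p u ∧
      (p.natDegree : ℕ∞) = C.multiplicity ∧ p.Monic ∧ Irreducible p ∧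
        IsDomain (AdjoinRoot p) := by
  have hm : (C.multiplicity.toNat : ℕ∞) = C.multiplicity := ENat.natCast_toNat C.multiplicity_ne_top
  obtain ⟨p, u, h, hdeg⟩ := PowerSeries.exists_weierstrass_polynomial (hΦ.trans hm.symm)
  have hirr : Irreducible p := by
    refine h.isDistinguishedAt.irreducible_of_irreducible_coe ?_
    rw [h.associated.irreducible_iff]
    exact (MulEquiv.irreducible_iff Φ).2 hC
  exact ⟨p, u, h, by rw [hdeg, hm], h.isDistinguishedAt.monic, hirr,
    AdjoinRoot.isDomain_of_prime hirr.prime⟩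

open scoped Valued in
/-- The strong triangle inequality for the order of contact, one of the three branches being smooth. -/
theorem coe_le_branchContact_triangle [Infinite K] {C D W : AlgebroidCurve K} (hC : C.IsBranch)
    (hD : D.IsBranch) (hW : W.IsSmoothBranch) (t : NNReal) :
    (t ≤ branchContact C W → t ≤ branchContact D W → t ≤ branchContact C D) ∧
    (t ≤ branchContact C D → t ≤ branchContact C W → t ≤ branchContact D W) := by
  obtain ⟨Φ, hΦC, hΦD, hΦW⟩ := MvPowerSeries.exists_algEquiv_order_eq C.equation_ne_zero
    D.equation_ne_zero W.equation_ne_zero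
  obtain ⟨f, u, hf, hfdeg, hfm, hfi, hfd⟩ := hC.exists_weierstrass_polynomial hΦC
  obtain ⟨g, v, hg, hgdeg, hgm, hgi, hgd⟩ := hD.exists_weierstrass_polynomial hΦD
  obtain ⟨w, x, hw, hwdeg, hwm, -, -⟩ := hW.1.exists_weierstrass_polynomial hΦW
  have hwdeg' : w.natDegree = 1 := by
    rw [hW.2] at hwdeg
    exact_mod_cast hwdeg
  obtain ⟨c, hc⟩ : ∃ c, w = Polynomial.X - Polynomial.C c := by
    refine ⟨-w.coeff 0, ?_⟩
    conv_lhs => rw [hwm.eq_X_add_C hwdeg']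
    rw [Polynomial.C_neg, sub_neg_eq_add]
  subst hc
  have hfpos : f.natDegree ≠ 0 := (hfm.natDegree_pos_of_not_isUnit hfi.not_isUnit).ne'
  have hgpos : g.natDegree ≠ 0 := (hgm.natDegree_pos_of_not_isUnit hgi.not_isUnit).ne'
  obtain ⟨q, hq0, hq1, hν⟩ := LaurentSeries.exists_norm_coe_eq_pow_order K
  obtain ⟨a, b, p, ha, hb, hp, hac, hbc, hpg, h1, h2⟩ :=
    exists_ultrametric_root_distances K⸨X⸩ hfm hgm hgi c
  have key := fun (h : K⟦X⟧) {k : ℕ} (hk : k ≠ 0) => ENNReal.coe_le_order_div_iff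
    (ν := fun h => ‖algebraMap K⟦X⟧ K⸨X⸩ h‖) hq0 hq1 (by simp) hν h hk t
  have hs : 0 ≤ q ^ (t : ℝ) := (Real.rpow_pos_of_pos hq0 _).le
  have hCW : t ≤ branchContact C W ↔ a ≤ q ^ (t : ℝ) := by
    rw [branchContact, intersectionNumber_eq_of_algEquiv C W Φ,
      hf.toENat_rank_quotient_sup hw.associated, ← hfdeg, hW.2, ENat.toENNReal_one, mul_one,
      ENat.toENNReal_coe, key _ hfpos, hac, pow_le_pow_iff_left₀ ha hs hfpos]
  have hDW : t ≤ branchContact D W ↔ b ≤ q ^ (t : ℝ) := by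
    rw [branchContact, intersectionNumber_eq_of_algEquiv D W Φ,
      hg.toENat_rank_quotient_sup hw.associated, ← hgdeg, hW.2, ENat.toENNReal_one, mul_one,
      ENat.toENNReal_coe, key _ hgpos, hbc, pow_le_pow_iff_left₀ hb hs hgpos]
  -- Extracting the m(C)-th root from the norm leaves a bound on |g(y)| by a power of exponent m(D).
  have hCD : t ≤ branchContact C D ↔ p ≤ (q ^ (t : ℝ)) ^ g.natDegree := by
    rw [branchContact, intersectionNumber_eq_of_algEquiv C D Φ,
      hf.toENat_rank_quotient_sup hg.associated, ← hfdeg, ← hgdeg, ENat.toENNReal_coe,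
      ENat.toENNReal_coe, ← Nat.cast_mul, key _ (mul_ne_zero hfpos hgpos), hpg,
      mul_comm f.natDegree, pow_mul, pow_le_pow_iff_left₀ hp (pow_nonneg hs _) hfpos]
  rw [hCW, hDW, hCD]
  exact ⟨h1 _, h2 _ hs⟩

theorem min_branchContact_le_of_smooth [Infinite K] {C D W : AlgebroidCurve K}
    (hC : C.IsBranch) (hD : D.IsBranch) (hW : W.IsSmoothBranch) :
    min (branchContact C W) (branchContact D W) ≤ branchContact C D :=
  ENNReal.le_of_forall_nnreal_lt fun t ht =>
    (coe_le_branchContact_triangle hC hD hW t).1 (ht.le.trans (min_le_left _ _))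
      (ht.le.trans (min_le_right _ _))

theorem min_branchContact_le_smooth [Infinite K] {C D W : AlgebroidCurve K}
    (hC : C.IsBranch) (hD : D.IsBranch) (hW : W.IsSmoothBranch) :
    min (branchContact C D) (branchContact C W) ≤ branchContact D W :=
  ENNReal.le_of_forall_nnreal_lt fun t ht =>
    (coe_le_branchContact_triangle hC hD hW t).2 (ht.le.trans (min_le_left _ _))
      (ht.le.trans (min_le_right _ _))

end AlgebroidCurve

/-! ### The contact exponent of a reduced curve -/

theorem mainTheorem2 {K : Type*} [Field K] [IsAlgClosed K]
    (C : AlgebroidCurve K) (hC : C.IsReduced)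
    {r : ℕ} (hr : 1 < r) (B : Fin r → AlgebroidCurve K)
    (hB_inj : Function.Injective B) (hB : Set.range B = C.branches) :
    C.contactExponent =
        min (⨅ i, (B i).contactExponent) (⨅ i, ⨅ j, AlgebroidCurve.contact (B i) (B j)) ∧
      ∃ i₀ : Fin r, ∀ W : AlgebroidCurve K, W.IsSmoothBranch →
        AlgebroidCurve.HasMaximalContact W (B i₀) → AlgebroidCurve.HasMaximalContact W C := by
  have : Infinite K := IsAlgClosed.instInfinite
  have hbr : ∀ i, (B i).IsBranch := fun i => (hB ▸ Set.mem_range_self i : B i ∈ C.branches).1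
  have hCW : ∀ W : AlgebroidCurve K, W.IsSmoothBranch →
      AlgebroidCurve.contact C W = ⨅ i, AlgebroidCurve.branchContact (B i) W := fun W hW => by
    rw [AlgebroidCurve.contact, ← hB, iInf_range]
    simp [AlgebroidCurve.branches_eq_singleton hW.1]
  have hBW : ∀ i W, AlgebroidCurve.IsSmoothBranch W →
      AlgebroidCurve.contact (B i) W = AlgebroidCurve.branchContact (B i) W := fun i W hW =>
    AlgebroidCurve.contact_eq_branchContact (hbr i) hW.1
  have hBB : ∀ i j, AlgebroidCurve.contact (B i) (B j) =
      AlgebroidCurve.branchContact (B i) (B j) := fun i j =>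
    AlgebroidCurve.contact_eq_branchContact (hbr i) (hbr j)
  set R := min (⨅ i, (B i).contactExponent) (⨅ i, ⨅ j, AlgebroidCurve.contact (B i) (B j))
    with hR
  have hle : C.contactExponent ≤ R := by
    refine iSup₂_le fun W hW => ?_
    rw [hCW W hW]
    refine le_min (le_iInf fun i => ?_) (le_iInf fun i => le_iInf fun j => ?_)
    · refine (iInf_le _ i).trans ?_
      rw [← hBW i W hW]
      exact le_iSup₂_of_le W hW le_rfl
    · rw [hBB]
      exact (le_min (iInf_le _ i) (iInf_le _ j)).trans
        (AlgebroidCurve.min_branchContact_le_of_smooth (hbr i) (hbr j) hW)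
  let i₀ : Fin r := ⟨0, zero_lt_one.trans hr⟩
  have hlow : ∀ W : AlgebroidCurve K, W.IsSmoothBranch →
      min R (AlgebroidCurve.contact (B i₀) W) ≤ AlgebroidCurve.contact C W := fun W hW => by
    rw [hCW W hW, hBW i₀ W hW]
    refine le_iInf fun j => ?_
    refine le_trans (min_le_min_right _ ?_)
      (AlgebroidCurve.min_branchContact_le_smooth (hbr i₀) (hbr j) hW)
    rw [← hBB]
    exact (min_le_right _ _).trans ((iInf_le _ i₀).trans (iInf_le _ j))
  have hR₀ : R ≤ (B i₀).contactExponent := (min_le_left _ _).trans (iInf_le _ i₀)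
  have heq : C.contactExponent = R := by
    refine le_antisymm hle ?_
    rw [← min_eq_left hR₀]
    -- Binary minimum distributes over the supremum, so the contact exponent of `B i₀` need not be
    -- attained.
    conv_lhs => rw [AlgebroidCurve.contactExponent, inf_iSup₂_eq]
    exact iSup₂_mono fun W hW => hlow W hW
  refine ⟨heq, i₀, fun W hW hmax => ⟨hW, le_antisymm (le_iSup₂_of_le W hW le_rfl) ?_⟩⟩
  have := hlow W hW
  rwa [hmax.2, min_eq_left hR₀, ← heq] at this
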